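/- Let $M$ be a unital $C^*$-algebra with norm $\|\cdot\|$, and let $M_h=\{x\in M: x^*=x\}$. A complex normed ideal in $M$ with a unitarily invariant norm is given by a two-sided ideal $\mathcal I_0$ of $M$ (a complex linear subspace, not necessarily closed) with a norm $\|\cdot\|_{\mathcal I}$ on the complex vector space $\mathcal I_0$ such that $$\|AZB\|_{\mathcal I}\le \|A\|\,\|Z\|_{\mathcal I}\,\|B\|\qquad\text{for all } A,B\in M,\ Z\in\mathcal I_0.$$ Let $\mathcal I$ be the completion of $\mathcal I_0$ with respect to $\|\cdot\|_{\mathcal I}$, with the norm still denoted $\|\cdot\|_{\mathcal I}$, and write $\mathcal I\cap M=\mathcal I_0$. Theorem. Let $(\mathcal I,\|\cdot\|_{\mathcal I})$ be a complex normed ideal in $M$ with a unitarily invariant norm, let $X,Y\in \mathcal I\cap M_h$ and let $t\in[0,1]$. Then $\ln(e^{-\frac t2X}e^{tY}e^{-\frac t2X})$ and $\ln(e^{-\frac X2}e^{Y}e^{-\frac X2})$ belong to $\mathcal I\cap M=\mathcal I_0$, and $$\left\|\ln\left(e^{-\frac t2X}e^{tY}e^{-\frac t2X}\right)\right\|_{\mathcal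 I}\le t\,\left\|\ln\left(e^{-\frac X2}e^{Y}e^{-\frac X2}\right)\right\|_{\mathcal I}.$$ Here $\ln$ of a positive invertible element of $M$ is its self-adjoint logarithm, given by the continuous functional calculus. -/

import Mathlib

/-- The data of a complex normed ideal with a unitarily invariant norm in a unital C*-algebra `M`:
a two-sided ideal `I₀` of `M` (not assumed closed, nor closed under the involution), which is a
complex linear subspace, with a norm of its own (not assumed complete, nor comparable with the norm
of `M`) such that `‖X Y Z‖_I ≤ ‖X‖ ‖Y‖_I ‖Z‖` for `X, Z ∈ M` and `Y ∈ I₀`. -/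
structure NormedIdeal (M : Type*) [CStarAlgebra M] where
  /-- the underlying linear subspace `I₀` of `M` -/
  space : Submodule ℂ M
  mul_mem_left : ∀ (X : M) {Y : M}, Y ∈ space → X * Y ∈ space
  mul_mem_right : ∀ {Y : M} (Z : M), Y ∈ space → Y * Z ∈ space
  /-- the norm of the ideal, as a function on `I₀` -/
  inorm : Seminorm ℂ space
  eq_zero_of_inorm : ∀ Y : space, inorm Y = 0 → Y = 0
  inorm_mul_mul_le : ∀ (X : M) (Y : space) (Z : M),
    inorm ⟨X * (Y : M) * Z, mul_mem_right Z (mul_mem_left X Y.2)⟩ ≤ ‖X‖ * inorm Y * ‖Z‖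

namespace NormedIdeal

variable {M : Type*} [CStarAlgebra M]

/-- The ideal `I₀` as a type, which carries the norm of the ideal (and not the norm of `M`). -/
def Core (I : NormedIdeal M) : Type _ := I.space

noncomputable instance (I : NormedIdeal M) : AddCommGroup I.Core :=
  inferInstanceAs (AddCommGroup I.space)

noncomputable instance (I : NormedIdeal M) : Module ℂ I.Core :=
  inferInstanceAs (Module ℂ I.space)

noncomputable instance (I : NormedIdeal M) : NormedAddCommGroup I.Core :=
  AddGroupNorm.toNormedAddCommGroup
    { toFun := fun Y => I.inorm Y
      map_zero' := map_zero I.inorm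
      add_le' := fun Y Z => map_add_le_add I.inorm Y Z
      neg' := fun Y => map_neg_eq_map I.inorm Y
      eq_zero_of_map_eq_zero' := fun Y hY => I.eq_zero_of_inorm Y hY }

noncomputable instance (I : NormedIdeal M) : NormedSpace ℂ I.Core where
  norm_smul_le c Y := le_of_eq (map_smul_eq_mul I.inorm c Y)

/-- The Banach space `I`, the completion of `I₀` in the norm of the ideal. -/
abbrev Completed (I : NormedIdeal M) : Type _ := UniformSpace.Completion I.Core

/-- An element of `M` that lies in the ideal, seen as an element of the Banach space `I`. -/
noncomputable def toCompleted (I : NormedIdeal M) (T : M) (hT : T ∈ I.space) : I.Completed :=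
  UniformSpace.Completion.coe' (α := I.Core) (⟨T, hT⟩ : I.space)

theorem norm_toCompleted (I : NormedIdeal M) (T : M) (hT : T ∈ I.space) :
    ‖I.toCompleted T hT‖ = I.inorm ⟨T, hT⟩ :=
  UniformSpace.Completion.norm_coe (E := I.Core) (⟨T, hT⟩ : I.space)

end NormedIdeal

/-- `ln (e^{-X/2} e^Y e^{-X/2})`, with the exponential and the (real) logarithm of the
C*-algebra `M`. For self-adjoint `X` and `Y` the argument of `ln` is positive and invertible. -/
noncomputable def lnExpConj {M : Type*} [CStarAlgebra M] (X Y : M) : M :=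
  CFC.log (NormedSpace.exp (-(1 / 2 : ℝ) • X) * NormedSpace.exp Y *
    NormedSpace.exp (-(1 / 2 : ℝ) • X))

/-! For self-adjoint `A`, `B` put D(A, B) = ‖e^{-A/2} e^{B/2} - e^{A/2} e^{-B/2}‖_I, a substitute
for the geodesic distance of e^A and e^B. It does not increase under congruence e^A ↦ g e^A g*, it
dominates ‖B - A‖_I, and D(tA, tB) ≤ t D(A, B) for t in [0, 1]. The last two facts come from a three
lines argument for H(z) = e^{-zA} e^{zB} - 1, since an imaginary shift of z only multiplies H(z) -
H(-conj z) by unitaries on each side (`norm_expDiff_le`).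

With K = ln(e^{-X/2} e^Y e^{-X/2}), the curve e^{X/2} e^{cK} e^{X/2} joins e^X to e^Y. Raising it to
the power t, conjugating by e^{-tX/2} and taking logarithms gives a curve C in the ideal from 0 to
the left-hand logarithm, with ‖C(b) - C(a)‖ ≤ t ‖2 sinh((b - a)K/2)‖. Summing over ever finer
subdivisions of [0, 1] turns the right side into t ‖K‖. -/

open Complex in
/-- A harmonic three lines theorem: if the norm of `H z - H (-conj z)` depends only on the real
part of `z`, then this norm grows at least linearly in the real part. -/
theorem norm_sub_neg_le_of_norm_eq_re {E : Type*} [NormedAddCommGroup E] [NormedSpace ℂ E]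
    {H : ℂ → E} (hH : Differentiable ℂ H)
    (h : ∀ z : ℂ, ‖H z - H (-(starRingEnd ℂ z))‖ ≤ ‖H (z.re : ℂ) - H (-(z.re : ℂ))‖)
    {x b : ℝ} (hx : 0 ≤ x) (hxb : x ≤ b) (hb : 0 < b) :
    ‖H (x : ℂ) - H (-(x : ℂ))‖ ≤ x / b * ‖H (b : ℂ) - H (-(b : ℂ))‖ := by
  obtain ⟨ψ, hψ, hψx⟩ := exists_dual_vector'' ℂ (H (x : ℂ) - H (-(x : ℂ)))
  have hconj : Differentiable ℂ fun z : ℂ => starRingEnd ℂ (ψ (H (-(starRingEnd ℂ z)))) := by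
    intro z
    have : DifferentiableAt ℂ (fun w : ℂ => ψ (H (-w))) (starRingEnd ℂ z) :=
      (ψ.differentiable.comp (hH.comp differentiable_neg)) _
    simpa [Function.comp_def] using this.conj_conj
  -- Conjugating the second term makes the exponent holomorphic without changing its real part,
  -- which is that of ψ(H(z) - H(-conj z)). On the imaginary axis -conj z = z, so |f| = 1 there.
  set f : ℂ → ℂ := fun z =>
    exp (ψ (H z) - starRingEnd ℂ (ψ (H (-(starRingEnd ℂ z))))) with hf
  have hfd : Differentiable ℂ f := ((ψ.differentiable.comp hH).sub hconj).cexp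
  have hfn : ∀ z, ‖f z‖ = Real.exp (ψ (H z - H (-(starRingEnd ℂ z)))).re := by
    intro z
    simp [hf, norm_exp]
  have hfle : ∀ z, ‖f z‖ ≤ Real.exp ‖H (z.re : ℂ) - H (-(z.re : ℂ))‖ := by
    intro z
    rw [hfn, Real.exp_le_exp]
    calc (ψ (H z - H (-(starRingEnd ℂ z)))).re
        ≤ ‖ψ (H z - H (-(starRingEnd ℂ z)))‖ := re_le_norm _
      _ ≤ 1 * ‖H z - H (-(starRingEnd ℂ z))‖ := ψ.le_of_opNorm_le hψ _
      _ ≤ _ := by rw [one_mul]; exact h z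
  have hbdd : BddAbove ((norm ∘ f) '' HadamardThreeLines.verticalClosedStrip 0 b) := by
    have hc : Continuous fun r : ℝ => Real.exp ‖H (r : ℂ) - H (-(r : ℂ))‖ := by
      have := hH.continuous
      fun_prop
    obtain ⟨C, hC⟩ := (isCompact_Icc (a := (0 : ℝ)) (b := b)).bddAbove_image hc.continuousOn
    refine ⟨C, ?_⟩
    rintro _ ⟨z, hz, rfl⟩
    exact (hfle z).trans (hC ⟨z.re, hz, rfl⟩)
  have key := HadamardThreeLines.norm_le_interp_of_mem_verticalClosedStrip' (f := f) (z := (x : ℂ))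
    (a := 1) (b := Real.exp ‖H (b : ℂ) - H (-(b : ℂ))‖) hb
    (by simp [HadamardThreeLines.verticalClosedStrip, hx, hxb])
    hfd.diffContOnCl hbdd
    (fun z hz => by
      have hz : z.re = 0 := hz
      simpa [hz] using hfle z)
    (fun z hz => by
      have hz : z.re = b := hz
      simpa [hz] using hfle z)
  rw [hfn, Real.one_rpow, one_mul, ← Real.exp_mul, Real.exp_le_exp] at key
  simp only [conj_ofReal, hψx, ofReal_re, sub_zero] at key
  rw [mul_comm]
  simpa using key

/-! ### Exponentials in a C*-algebra -/

namespace CStarAlgebra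

variable {M : Type*} [CStarAlgebra M]

/-- The one-parameter group `z ↦ e^{z A}`. -/
noncomputable def expSMul (A : M) (z : ℂ) : M := NormedSpace.exp (z • A)

theorem expSMul_zero (A : M) : expSMul A 0 = 1 := by simp [expSMul]

theorem expSMul_add (A : M) (z w : ℂ) : expSMul A (z + w) = expSMul A z * expSMul A w := by
  let : NormedAlgebra ℚ M := .restrictScalars ℚ ℂ M
  rw [expSMul, add_smul]
  exact NormedSpace.exp_add_of_commute (((Commute.refl A).smul_left z).smul_right w)

@[simp] theorem expSMul_mul_neg (A : M) (z : ℂ) : expSMul A z * expSMul A (-z) = 1 := by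
  rw [← expSMul_add, add_neg_cancel, expSMul_zero]

@[simp] theorem expSMul_neg_mul (A : M) (z : ℂ) : expSMul A (-z) * expSMul A z = 1 := by
  rw [← expSMul_add, neg_add_cancel, expSMul_zero]

theorem isUnit_expSMul (A : M) (z : ℂ) : IsUnit (expSMul A z) :=
  ⟨⟨_, _, expSMul_mul_neg A z, expSMul_neg_mul A z⟩, rfl⟩

theorem star_expSMul {A : M} (hA : IsSelfAdjoint A) (z : ℂ) :
    star (expSMul A z) = expSMul A (starRingEnd ℂ z) := by
  rw [expSMul, expSMul, NormedSpace.star_exp, star_smul, hA.star_eq]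
  rfl

theorem continuous_expSMul (A : M) : Continuous (expSMul A) := by
  let : NormedAlgebra ℚ M := .restrictScalars ℚ ℂ M
  unfold expSMul
  exact NormedSpace.exp_continuous.comp (by fun_prop)

theorem expSMul_smul (A : M) (r : ℝ) (z : ℂ) : expSMul (r • A) z = expSMul A (r * z) := by
  rw [expSMul, expSMul, ← Complex.coe_smul, smul_smul, mul_comm]

theorem exp_smul_eq_expSMul (A : M) (r : ℝ) : NormedSpace.exp (r • A) = expSMul A r := by
  rw [expSMul, Complex.coe_smul]

theorem exp_eq_expSMul (A : M) : NormedSpace.exp A = expSMul A 1 := by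
  rw [expSMul, one_smul]

theorem isSelfAdjoint_expSMul {A : M} (hA : IsSelfAdjoint A) (r : ℝ) :
    IsSelfAdjoint (expSMul A r) := by
  rw [IsSelfAdjoint, star_expSMul hA, Complex.conj_ofReal]

theorem norm_le_one_of_star_mul_self {u : M} (hu : star u * u = 1) : ‖u‖ ≤ 1 := by
  nontriviality M
  have := CStarRing.norm_star_mul_self (x := u)
  rw [hu, norm_one] at this
  nlinarith [norm_nonneg u]

theorem norm_expSMul_le_one {A : M} (hA : IsSelfAdjoint A) {z : ℂ} (hz : z.re = 0) :
    ‖expSMul A z‖ ≤ 1 := by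
  apply norm_le_one_of_star_mul_self
  rw [star_expSMul hA, show starRingEnd ℂ z = -z by
    apply Complex.ext <;> simp [hz], expSMul_neg_mul]

/-- The average `∫₀¹ e^{s z A} ds`. -/
noncomputable def expMean (A : M) (z : ℂ) : M := ∫ s in (0 : ℝ)..1, expSMul A (s * z)

theorem continuous_expMean (A : M) : Continuous (expMean A) := by
  unfold expMean
  have hA := continuous_expSMul A
  exact intervalIntegral.continuous_parametric_intervalIntegral_of_continuous
    (f := fun (z : ℂ) (s : ℝ) => expSMul A (s * z))
    (hA.comp (by fun_prop)) continuous_const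

theorem expMean_zero (A : M) : expMean A 0 = 1 := by
  simp [expMean, expSMul_zero]

/-- Puts e^{zA} - 1 in the ideal when A is. The integral is taken in `M`, so no completeness of the
ideal norm is needed. -/
theorem mul_expMean (A : M) (z : ℂ) : A * (z • expMean A z) = expSMul A z - 1 := by
  let : NormedAlgebra ℚ M := .restrictScalars ℚ ℂ M
  have hd : ∀ s : ℝ, HasDerivAt (fun s : ℝ => expSMul A (s * z))
      (A * (z • expSMul A (s * z))) s := by
    intro s
    have h := hasDerivAt_exp_smul_const' (𝕂 := ℝ) (z • A) s
    simp only [expSMul, mul_smul, Complex.coe_smul]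
    convert h using 1
    rw [mul_smul_comm, smul_mul_assoc]
  have hc := (continuous_expSMul A).comp (show Continuous fun s : ℝ => (s : ℂ) * z by fun_prop)
  have := intervalIntegral.integral_eq_sub_of_hasDerivAt (a := 0) (b := 1) (fun s _ => hd s)
    ((continuous_const.mul (hc.const_smul z)).intervalIntegrable 0 1)
  simp only [Complex.ofReal_one, one_mul, Complex.ofReal_zero, zero_mul, expSMul_zero] at this
  rw [← this, expMean, ← intervalIntegral.integral_smul]
  exact (((ContinuousLinearMap.mul ℂ M) A).intervalIntegral_comp_comm
    ((hc.const_smul z).intervalIntegrable 0 1)).symm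

theorem exp_log_conj {A g : M} (hA : IsSelfAdjoint A) (hg : IsUnit g) :
    NormedSpace.exp (CFC.log (g * NormedSpace.exp A * star g)) =
      g * NormedSpace.exp A * star g := by
  let := CStarAlgebra.spectralOrder M
  have := CStarAlgebra.spectralOrderedRing M
  apply CFC.exp_log
  rw [IsStrictlyPositive.iff_of_unital]
  refine ⟨star_right_conjugate_nonneg hA.exp_nonneg g, (hg.mul ?_).mul hg.star⟩
  rw [exp_eq_expSMul]
  exact isUnit_expSMul A 1

end CStarAlgebra

/-! ### Two-sided multiplication and logarithms in the ideal -/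

namespace NormedIdeal

open CStarAlgebra

variable {M : Type*} [CStarAlgebra M] (I : NormedIdeal M)

/-- The element of `M` underlying an element of the ideal. -/
noncomputable def val : I.Core →ₗ[ℂ] M := I.space.subtype

variable {I}

theorem val_injective : Function.Injective I.val := Subtype.val_injective

theorem val_mem (Z : I.Core) : I.val Z ∈ I.space := Z.2

variable (I) in
/-- An element of `M` that lies in the ideal, as an element of the ideal. -/
noncomputable def core (T : M) (hT : T ∈ I.space) : I.Core := (⟨T, hT⟩ : I.space)

@[simp] theorem val_core (T : M) (hT : T ∈ I.space) : I.val (I.core T hT) = T := rfl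

/-- The two-sided multiplication `Z ↦ P Z Q`. -/
noncomputable def sandwich (P Q : M) (Z : I.Core) : I.Core :=
  I.core (P * I.val Z * Q) (I.mul_mem_right Q (I.mul_mem_left P (val_mem Z)))

@[simp] theorem val_sandwich (P Q : M) (Z : I.Core) :
    I.val (sandwich P Q Z) = P * I.val Z * Q := rfl

theorem norm_sandwich_le (P Q : M) (Z : I.Core) : ‖sandwich P Q Z‖ ≤ ‖P‖ * ‖Z‖ * ‖Q‖ :=
  I.inorm_mul_mul_le P Z Q

theorem norm_le_of_val_eq {Z W : I.Core} {u v : M} (hu : ‖u‖ ≤ 1) (hv : ‖v‖ ≤ 1)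
    (h : I.val Z = u * I.val W * v) : ‖Z‖ ≤ ‖W‖ := by
  have : Z = sandwich u v W := val_injective h
  rw [this]
  calc ‖sandwich u v W‖ ≤ ‖u‖ * ‖W‖ * ‖v‖ := norm_sandwich_le u v W
    _ ≤ 1 * ‖W‖ * 1 := by gcongr
    _ = ‖W‖ := by ring

/-- The two-sided multiplication `Z ↦ P Z Q` as a continuous linear map of `Z`. -/
noncomputable def sandwichCLM (P Q : M) : I.Core →L[ℂ] I.Core :=
  LinearMap.mkContinuous
    { toFun := sandwich P Q
      map_add' := fun Z W => val_injective (by simp [mul_add, add_mul])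
      map_smul' := fun c Z => val_injective (by simp) }
    (‖P‖ * ‖Q‖) fun Z => (norm_sandwich_le P Q Z).trans_eq (by ring)

/-- The multiplication `Q ↦ Z Q` as a continuous linear map from `M` to the ideal. -/
noncomputable def mulCLM (Z : I.Core) : M →L[ℂ] I.Core :=
  LinearMap.mkContinuous
    { toFun := fun Q => sandwich 1 Q Z
      map_add' := fun P Q => val_injective (by simp [mul_add])
      map_smul' := fun c Q => val_injective (by simp) }
    (‖(1 : M)‖ * ‖Z‖) fun Q => norm_sandwich_le 1 Q Z

@[simp] theorem val_mulCLM (Z : I.Core) (Q : M) : I.val (mulCLM Z Q) = I.val Z * Q := by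
  change 1 * I.val Z * Q = _
  rw [one_mul]

/-- As x/(e^x - 1) extends continuously to 0, ln a is a - 1 times an element of `M`; the ideal need
not be closed. -/
theorem log_mem {A g : M} (hA : IsSelfAdjoint A) (hg : IsUnit g)
    (h : g * NormedSpace.exp A * star g - 1 ∈ I.space) :
    CFC.log (g * NormedSpace.exp A * star g) ∈ I.space := by
  set a := g * NormedSpace.exp A * star g with ha
  have hexp := exp_log_conj hA hg
  rw [← ha] at hexp
  set K := CFC.log a with hK
  have hKs : IsSelfAdjoint K := IsSelfAdjoint.log
  have hc1 : Continuous (fun x : ℝ => Real.exp x - 1) := by fun_prop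
  -- `dslope` is (e^x - 1)/x with its removable singularity at 0 filled in.
  have hc2 : Continuous (dslope Real.exp 0) := by
    rw [← continuousOn_univ, continuousOn_dslope Filter.univ_mem]
    exact ⟨Real.continuous_exp.continuousOn, Real.differentiableAt_exp⟩
  have hne : ∀ x, dslope Real.exp 0 x ≠ 0 := by
    intro x
    rcases eq_or_ne x 0 with rfl | hx
    · simp
    · rw [dslope_of_ne _ hx, slope_def_field, sub_zero, Real.exp_zero]
      exact div_ne_zero (sub_ne_zero.mpr (by simpa using hx)) hx
  have hc3 : Continuous fun x : ℝ => (dslope Real.exp 0 x)⁻¹ := hc2.inv₀ hne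
  have hprod : K = (a - 1) * cfc (fun x : ℝ => (dslope Real.exp 0 x)⁻¹) K := by
    have h1 : a - 1 = cfc (fun x : ℝ => Real.exp x - 1) K := by
      rw [cfc_sub (fun x : ℝ => Real.exp x) (fun _ => (1 : ℝ)) K
        Real.continuous_exp.continuousOn continuousOn_const,
        CFC.real_exp_eq_normedSpace_exp hKs, hexp, cfc_const_one ℝ K]
    rw [h1, ← cfc_mul _ _ K hc1.continuousOn hc3.continuousOn]
    conv_lhs => rw [← cfc_id' ℝ K]
    refine cfc_congr fun x _ => ?_
    have := sub_smul_dslope Real.exp 0 x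
    rw [Real.exp_zero, sub_zero, smul_eq_mul] at this
    rw [← this, mul_assoc, mul_inv_cancel₀ (hne x), mul_one]
  rw [hprod]
  exact I.mul_mem_right _ h

/-! ### The entire function e^{-zA} e^{zB} - 1 with values in the ideal -/

theorem expSMul_mul_expSMul_sub_one (A B : M) (z : ℂ) :
    expSMul A (-z) * expSMul B z - 1 =
      A * (-z • expMean A (-z) * expSMul B z) + B * (z • expMean B z) := by
  have h1 := mul_expMean A (-z)
  have h2 := mul_expMean B z
  rw [← mul_assoc, h1, h2]
  noncomm_ring

/-- The element `e^{-z A} e^{z B} - 1` of the ideal. -/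
noncomputable def expQuot (A B : I.Core) (z : ℂ) : I.Core :=
  mulCLM A (-z • expMean (I.val A) (-z) * expSMul (I.val B) z) +
    mulCLM B (z • expMean (I.val B) z)

theorem val_expQuot (A B : I.Core) (z : ℂ) :
    I.val (expQuot A B z) = expSMul (I.val A) (-z) * expSMul (I.val B) z - 1 := by
  rw [expSMul_mul_expSMul_sub_one, expQuot, map_add, val_mulCLM, val_mulCLM]

theorem hasDerivAt_expQuot_zero (A B : I.Core) : HasDerivAt (expQuot A B) (B - A) 0 := by
  have key : ∀ g : ℂ → M, Continuous g → HasDerivAt (fun z : ℂ => z • g z) (g 0) 0 := by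
    intro g hg
    rw [hasDerivAt_iff_tendsto_slope]
    refine (hg.continuousAt.tendsto.mono_left nhdsWithin_le_nhds).congr' ?_
    filter_upwards [self_mem_nhdsWithin] with z hz
    rw [slope_def_module]
    simp [smul_smul, inv_mul_cancel₀ (show z ≠ 0 from hz)]
  have hA := continuous_expMean (I.val A)
  have hB := continuous_expMean (I.val B)
  have hE := continuous_expSMul (I.val B)
  have h1 := (mulCLM A).hasFDerivAt.comp_hasDerivAt (0 : ℂ)
    (key (fun z => -(expMean (I.val A) (-z) * expSMul (I.val B) z)) (by fun_prop))
  have h2 := (mulCLM B).hasFDerivAt.comp_hasDerivAt (0 : ℂ) (key _ hB)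
  refine ((h1.add h2).congr_deriv ?_).congr_of_eventuallyEq (Filter.Eventually.of_forall ?_)
  · apply val_injective
    simp [expMean_zero, expSMul_zero]
    abel
  · intro z
    apply val_injective
    simp [expQuot]

theorem differentiable_expQuot (A B : I.Core) : Differentiable ℂ (expQuot A B) := by
  intro w
  -- The group law moves the derivative at w to the one at 0.
  have h : ∀ z, expQuot A B z = sandwichCLM (expSMul (I.val A) (-w)) (expSMul (I.val B) w)
      (expQuot A B (z - w)) + expQuot A B w := by
    intro z
    apply val_injective
    rw [map_add, val_expQuot, val_expQuot]
    change _ = expSMul (I.val A) (-w) * I.val (expQuot A B (z - w)) * expSMul (I.val B) w + _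
    rw [val_expQuot, mul_sub, sub_mul, mul_one, ← mul_assoc, mul_assoc _ _ (expSMul (I.val B) w),
      ← expSMul_add, ← expSMul_add, sub_add_cancel, show -w + -(z - w) = -z by ring]
    abel
  rw [show expQuot A B = _ from funext h]
  have hd : HasDerivAt (expQuot A B) (B - A) (w - w) := by
    rw [sub_self]
    exact hasDerivAt_expQuot_zero A B
  exact ((sandwichCLM _ _).differentiableAt.comp w
    (hd.comp_sub_const w w).differentiableAt).add_const _

/-! ### Growth and congruence of the substitute distance -/

/-- The element `e^{-x A} e^{x B} - e^{x A} e^{-x B}` of the ideal. -/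
noncomputable def expDiff (A B : I.Core) (x : ℝ) : I.Core :=
  expQuot A B x - expQuot A B (-x)

theorem val_expDiff (A B : I.Core) (x : ℝ) :
    I.val (expDiff A B x) = expSMul (I.val A) (-x) * expSMul (I.val B) x -
      expSMul (I.val A) x * expSMul (I.val B) (-x) := by
  rw [expDiff, map_sub, val_expQuot, val_expQuot, neg_neg, sub_sub_sub_cancel_right]

theorem norm_expDiff_le (A B : I.Core) (hA : IsSelfAdjoint (I.val A))
    (hB : IsSelfAdjoint (I.val B)) {x b : ℝ} (hx : 0 ≤ x) (hxb : x ≤ b) (hb : 0 < b) :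
    ‖expDiff A B x‖ ≤ x / b * ‖expDiff A B b‖ := by
  refine norm_sub_neg_le_of_norm_eq_re (differentiable_expQuot A B) (fun z => ?_) hx hxb hb
  have hz : z = (z.re : ℂ) + z.im * Complex.I := (Complex.re_add_im z).symm
  have hc : -(starRingEnd ℂ z) = -(z.re : ℂ) + z.im * Complex.I := by
    apply Complex.ext <;> simp
  -- For z = x + iy the unitaries e^{-iyA} and e^{iyB} factor out on the left and on the right.
  refine norm_le_of_val_eq (u := expSMul (I.val A) (-(z.im * Complex.I)))
    (v := expSMul (I.val B) (z.im * Complex.I))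
    (norm_expSMul_le_one hA (by simp)) (norm_expSMul_le_one hB (by simp)) ?_
  rw [map_sub, map_sub, val_expQuot, val_expQuot, val_expQuot, val_expQuot, hc]
  nth_rw 1 2 [hz]
  simp only [sub_sub_sub_cancel_right, neg_neg, neg_add, mul_sub, sub_mul]
  have e1 : ∀ r s : ℂ, expSMul (I.val A) (r + s) = expSMul (I.val A) s * expSMul (I.val A) r :=
    fun r s => by rw [add_comm, expSMul_add]
  simp only [e1, expSMul_add (I.val B), mul_assoc]

theorem hasDerivAt_expDiff_zero (A B : I.Core) :
    HasDerivAt (expDiff A B) ((2 : ℝ) • (B - A)) 0 := by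
  have h := hasDerivAt_expQuot_zero A B
  have h1 : HasDerivAt (fun x : ℝ => expQuot A B x) (B - A) 0 := by
    rw [← Complex.ofReal_zero] at h
    simpa [Function.comp_def] using h.scomp (0 : ℝ) Complex.ofRealCLM.hasDerivAt
  have h2 : HasDerivAt (fun x : ℝ => expQuot A B (-x)) (-(B - A)) 0 := by
    have h3 : HasDerivAt (fun x : ℝ => expQuot A B x) (B - A) (-0) := by simpa using h1
    have h4 := h3.scomp (0 : ℝ) (hasDerivAt_neg (0 : ℝ))
    simpa [Function.comp_def] using h4
  exact (h1.sub h2).congr_deriv (by rw [two_smul]; abel)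

theorem tendsto_expDiff (A B : I.Core) :
    Filter.Tendsto (fun x : ℝ => x⁻¹ * ‖expDiff A B x‖) (nhdsWithin 0 (Set.Ioi 0))
      (nhds (2 * ‖B - A‖)) := by
  have h := (hasDerivAt_expDiff_zero A B).tendsto_slope_zero_right.norm
  rw [norm_smul, Real.norm_two] at h
  refine h.congr' ?_
  filter_upwards [self_mem_nhdsWithin] with x hx
  have h0 : expDiff A B 0 = 0 := by simp [expDiff]
  rw [zero_add, h0, sub_zero, norm_smul, norm_inv, Real.norm_of_nonneg (le_of_lt hx)]

/-- By `norm_expDiff_le` the quotient ‖`expDiff A B x`‖/x for 0 < x < 1/2 is at most its value at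
1/2; its limit at 0 is 2‖B - A‖. -/
theorem norm_sub_le_expDiff (A B : I.Core) (hA : IsSelfAdjoint (I.val A))
    (hB : IsSelfAdjoint (I.val B)) : ‖B - A‖ ≤ ‖expDiff A B (1 / 2)‖ := by
  have : 2 * ‖B - A‖ ≤ 2 * ‖expDiff A B (1 / 2)‖ := by
    refine le_of_tendsto (tendsto_expDiff A B) ?_
    filter_upwards [Ioo_mem_nhdsGT (show (0 : ℝ) < 1 / 2 by norm_num)] with x hx
    have h := norm_expDiff_le A B hA hB hx.1.le hx.2.le (by norm_num)
    rw [inv_mul_le_iff₀ hx.1]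
    exact h.trans_eq (by ring)
  linarith

theorem norm_expDiff_smul_le (A B : I.Core) (hA : IsSelfAdjoint (I.val A))
    (hB : IsSelfAdjoint (I.val B)) {t : ℝ} (ht0 : 0 ≤ t) (ht1 : t ≤ 1) :
    ‖expDiff (t • A) (t • B) (1 / 2)‖ ≤ t * ‖expDiff A B (1 / 2)‖ := by
  have hv : ∀ Z : I.Core, I.val (t • Z) = t • I.val Z := fun Z => rfl
  have h : expDiff (t • A) (t • B) (1 / 2) = expDiff A B (t / 2) := by
    apply val_injective
    simp only [val_expDiff, hv, expSMul_smul]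
    push_cast
    ring_nf
  rw [h]
  exact (norm_expDiff_le A B hA hB (x := t / 2) (b := 1 / 2) (by linarith) (by linarith)
    (by norm_num)).trans_eq (by ring)

/-- The distance `‖expDiff A B (1 / 2)‖` between `e^A` and `e^B` is invariant under
congruences. -/
theorem norm_expDiff_le_of_congruence {A B A' B' : I.Core} (g : M)
    (hA : IsSelfAdjoint (I.val A)) (hB : IsSelfAdjoint (I.val B))
    (hA' : IsSelfAdjoint (I.val A')) (hB' : IsSelfAdjoint (I.val B'))
    (hAA : NormedSpace.exp (I.val A') = g * NormedSpace.exp (I.val A) * star g)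
    (hBB : NormedSpace.exp (I.val B') = g * NormedSpace.exp (I.val B) * star g) :
    ‖expDiff A' B' (1 / 2)‖ ≤ ‖expDiff A B (1 / 2)‖ := by
  have half : ∀ C : M, NormedSpace.exp C = expSMul C (1 / 2 : ℝ) * expSMul C (1 / 2 : ℝ) :=
    fun C => by rw [exp_eq_expSMul, ← expSMul_add]; norm_num
  have hsa : ∀ {C : M}, IsSelfAdjoint C → ∀ s : ℝ, star (expSMul C s) = expSMul C s :=
    fun hC s => isSelfAdjoint_expSMul hC s
  have hsa' : ∀ {C : M}, IsSelfAdjoint C → ∀ s : ℝ, star (expSMul C (-s)) = expSMul C (-s) :=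
    fun hC s => by simpa [IsSelfAdjoint] using isSelfAdjoint_expSMul hC (-s)
  rw [half, half] at hAA hBB
  -- With u = e^{-C'/2} g e^{C/2}, the relation e^{C'} = g e^C g* says u u* = 1. The new difference
  -- is u_A (old difference) u_B*.
  have huu : ∀ {C C' : M}, IsSelfAdjoint C → IsSelfAdjoint C' →
      expSMul C' (1 / 2 : ℝ) * expSMul C' (1 / 2 : ℝ) =
        g * (expSMul C (1 / 2 : ℝ) * expSMul C (1 / 2 : ℝ)) * star g →
      ‖star (expSMul C' (-(1 / 2 : ℝ)) * g * expSMul C (1 / 2 : ℝ))‖ ≤ 1 := by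
    intro C C' hC hC' h
    apply norm_le_one_of_star_mul_self
    rw [star_star, star_mul, star_mul, hsa hC, hsa' hC']
    calc _ = expSMul C' (-(1 / 2 : ℝ)) *
          (g * (expSMul C (1 / 2 : ℝ) * expSMul C (1 / 2 : ℝ)) * star g) *
          expSMul C' (-(1 / 2 : ℝ)) := by simp only [mul_assoc]
      _ = 1 := by rw [← h, ← mul_assoc, expSMul_neg_mul, one_mul, expSMul_mul_neg]
  have hu := huu hA hA' hAA
  rw [norm_star] at hu
  refine norm_le_of_val_eq hu (huu hB hB' hBB) ?_
  rw [val_expDiff, val_expDiff, mul_sub, sub_mul, star_mul, star_mul, hsa hB, hsa' hB']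
  congr 1
  · calc _ = expSMul (I.val A') (-(1 / 2 : ℝ)) *
          (expSMul (I.val B') (1 / 2 : ℝ) * expSMul (I.val B') (1 / 2 : ℝ)) *
          expSMul (I.val B') (-(1 / 2 : ℝ)) := by
            simp only [mul_assoc, expSMul_mul_neg, mul_one]
      _ = expSMul (I.val A') (-(1 / 2 : ℝ)) * g *
          (expSMul (I.val A) (1 / 2 : ℝ) * expSMul (I.val A) (-(1 / 2 : ℝ))) *
          (expSMul (I.val B) (1 / 2 : ℝ) * expSMul (I.val B) (1 / 2 : ℝ)) * star g *
          expSMul (I.val B') (-(1 / 2 : ℝ)) := by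
            rw [hBB, expSMul_mul_neg, mul_one]; simp only [mul_assoc]
      _ = _ := by simp only [mul_assoc]
  · calc _ = expSMul (I.val A') (-(1 / 2 : ℝ)) *
          (expSMul (I.val A') (1 / 2 : ℝ) * expSMul (I.val A') (1 / 2 : ℝ)) *
          expSMul (I.val B') (-(1 / 2 : ℝ)) := by
            rw [← mul_assoc (expSMul _ _), expSMul_neg_mul, one_mul]
      _ = expSMul (I.val A') (-(1 / 2 : ℝ)) * g *
          (expSMul (I.val A) (1 / 2 : ℝ) * expSMul (I.val A) (1 / 2 : ℝ)) *
          (expSMul (I.val B) (-(1 / 2 : ℝ)) * expSMul (I.val B) (1 / 2 : ℝ)) * star g *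
          expSMul (I.val B') (-(1 / 2 : ℝ)) := by
            rw [hAA, expSMul_neg_mul, mul_one]; simp only [mul_assoc]
      _ = _ := by simp only [mul_assoc]

/-! ### Logarithms of congruent exponentials -/

theorem isSelfAdjoint_real_smul {A : M} (hA : IsSelfAdjoint A) (r : ℝ) :
    IsSelfAdjoint (r • A) := IsSelfAdjoint.smul (by simp [IsSelfAdjoint]) hA

theorem real_smul_mem {A : M} (hA : A ∈ I.space) (r : ℝ) : r • A ∈ I.space := by
  rw [← Complex.coe_smul]; exact I.space.smul_mem _ hA

theorem exp_sub_one_mem {A : M} (hA : A ∈ I.space) : NormedSpace.exp A - 1 ∈ I.space := by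
  rw [exp_eq_expSMul, ← mul_expMean]
  exact I.mul_mem_right _ hA

/-- The logarithm of `e^{r X} e^A e^{r X}`, for self-adjoint `X` and `A` in the ideal. -/
noncomputable def logConj (X : M) (r : ℝ) (A : M) : M :=
  CFC.log (NormedSpace.exp (r • X) * NormedSpace.exp A * NormedSpace.exp (r • X))

theorem exp_logConj {X A : M} (hX : IsSelfAdjoint X) (hA : IsSelfAdjoint A) (r : ℝ) :
    NormedSpace.exp (logConj X r A) =
      NormedSpace.exp (r • X) * NormedSpace.exp A * NormedSpace.exp (r • X) := by
  have h := exp_log_conj hA (isUnit_expSMul X r)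
  rwa [isSelfAdjoint_expSMul hX, ← exp_smul_eq_expSMul] at h

theorem isSelfAdjoint_logConj (X : M) (r : ℝ) (A : M) : IsSelfAdjoint (logConj X r A) :=
  IsSelfAdjoint.log

theorem logConj_mem {X A : M} (hX : IsSelfAdjoint X) (hA : IsSelfAdjoint A)
    (hXI : X ∈ I.space) (hAI : A ∈ I.space) (r : ℝ) : logConj X r A ∈ I.space := by
  have h := log_mem (I := I) hA (isUnit_expSMul X r)
  rw [isSelfAdjoint_expSMul hX, ← exp_smul_eq_expSMul] at h
  refine h ?_
  have hrX : r • X ∈ I.space := real_smul_mem hXI r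
  have e : NormedSpace.exp (r • X) * NormedSpace.exp A * NormedSpace.exp (r • X) - 1 =
      (NormedSpace.exp (r • X) - 1) * (NormedSpace.exp A * NormedSpace.exp (r • X)) +
      ((NormedSpace.exp A - 1) * NormedSpace.exp (r • X) + (NormedSpace.exp (r • X) - 1)) := by
    noncomm_ring
  rw [e]
  exact I.space.add_mem (I.mul_mem_right _ (exp_sub_one_mem hrX))
    (I.space.add_mem (I.mul_mem_right _ (exp_sub_one_mem hAI)) (exp_sub_one_mem hrX))

/-- Conjugating by `e^{r X}` and then by `e^{-r X}` is the identity. -/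
theorem logConj_logConj_neg {X A : M} (hX : IsSelfAdjoint X) (hA : IsSelfAdjoint A) (r : ℝ) :
    logConj X (-r) (logConj X r A) = A := by
  rw [logConj, exp_logConj hX hA]
  conv_rhs => rw [← CFC.log_exp A hA]
  congr 1
  simp only [exp_smul_eq_expSMul, Complex.ofReal_neg]
  calc _ = (expSMul X (-r) * expSMul X r) * NormedSpace.exp A *
        (expSMul X r * expSMul X (-r)) := by simp only [mul_assoc]
    _ = _ := by rw [expSMul_neg_mul, expSMul_mul_neg, one_mul, mul_one]

theorem logConj_zero {X : M} (hX : IsSelfAdjoint X) (r : ℝ) : logConj X r 0 = (2 * r) • X := by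
  rw [logConj, NormedSpace.exp_zero, mul_one, exp_smul_eq_expSMul, ← expSMul_add,
    ← Complex.ofReal_add, ← exp_smul_eq_expSMul, ← two_mul]
  exact CFC.log_exp _ (isSelfAdjoint_real_smul hX _)

theorem lnExpConj_eq_logConj (X Y : M) : lnExpConj X Y = logConj X (-(1 / 2)) Y := rfl

theorem lnExpConj_smul (X Y : M) (t : ℝ) :
    lnExpConj (t • X) (t • Y) = logConj X (-(t / 2)) (t • Y) := by
  rw [lnExpConj, logConj, smul_smul, show -(1 / 2) * t = -(t / 2) by ring]

/-! ### Comparison along the geodesic -/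

/-- The distance between the points at parameters `a` and `b` of the one-parameter group of `K`
is not increased by passing to powers with exponent `t`, conjugated. -/
theorem norm_logConj_sub_logConj_le {X K : M} (hX : IsSelfAdjoint X) (hK : IsSelfAdjoint K)
    (hXI : X ∈ I.space) (hKI : K ∈ I.space) {t : ℝ} (ht0 : 0 ≤ t) (ht1 : t ≤ 1) (r s a b : ℝ) :
    ‖I.core (logConj X s (t • logConj X r (b • K)))
        (logConj_mem hX (isSelfAdjoint_real_smul (isSelfAdjoint_logConj _ _ _) t) hXI
          (real_smul_mem (logConj_mem hX (isSelfAdjoint_real_smul hK b) hXI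
            (real_smul_mem hKI b) r) t) s) -
      I.core (logConj X s (t • logConj X r (a • K)))
        (logConj_mem hX (isSelfAdjoint_real_smul (isSelfAdjoint_logConj _ _ _) t) hXI
          (real_smul_mem (logConj_mem hX (isSelfAdjoint_real_smul hK a) hXI
            (real_smul_mem hKI a) r) t) s)‖ ≤
      t * ‖expDiff 0 (I.core K hKI) ((b - a) / 2)‖ := by
  have hL : ∀ c : ℝ, IsSelfAdjoint (logConj X r (c • K)) := fun c => isSelfAdjoint_logConj _ _ _
  have hKc := isSelfAdjoint_real_smul hK
  have hLI : ∀ c : ℝ, logConj X r (c • K) ∈ I.space := fun c =>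
    logConj_mem hX (hKc c) hXI (real_smul_mem hKI c) r
  have hexp : ∀ r : ℝ, star (NormedSpace.exp (r • X)) = NormedSpace.exp (r • X) := fun r => by
    rw [exp_smul_eq_expSMul, isSelfAdjoint_expSMul hX]
  have hv : ∀ (c : ℝ) (Z : I.Core), I.val (c • Z) = c • I.val Z := fun c Z => rfl
  calc _ ≤ _ := norm_sub_le_expDiff _ _ (isSelfAdjoint_logConj _ _ _) (isSelfAdjoint_logConj _ _ _)
    _ ≤ ‖expDiff (t • I.core _ (hLI a)) (t • I.core _ (hLI b)) (1 / 2)‖ := by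
      refine norm_expDiff_le_of_congruence (NormedSpace.exp (s • X))
        (isSelfAdjoint_real_smul (hL a) t) (isSelfAdjoint_real_smul (hL b) t)
        (isSelfAdjoint_logConj _ _ _) (isSelfAdjoint_logConj _ _ _) ?_ ?_ <;>
      rw [hexp] <;>
      exact exp_logConj hX (isSelfAdjoint_real_smul (hL _) t) s
    _ ≤ t * ‖expDiff (I.core _ (hLI a)) (I.core _ (hLI b)) (1 / 2)‖ :=
      norm_expDiff_smul_le _ _ (hL a) (hL b) ht0 ht1
    _ ≤ t * ‖expDiff (I.core (a • K) (real_smul_mem hKI a)) (I.core (b • K) (real_smul_mem hKI b))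
          (1 / 2)‖ := by
      refine mul_le_mul_of_nonneg_left ?_ ht0
      refine norm_expDiff_le_of_congruence (NormedSpace.exp (r • X))
        (hKc a) (hKc b) (hL a) (hL b) ?_ ?_ <;>
      rw [hexp] <;>
      exact exp_logConj hX (hKc _) r
    -- aK and bK commute, so only b - a matters.
    _ = t * ‖expDiff 0 (I.core K hKI) ((b - a) / 2)‖ := by
      congr 2
      apply val_injective
      have h0 : ∀ z, expSMul (0 : M) z = 1 := fun z => by simp [expSMul]
      simp only [val_expDiff, val_core, expSMul_smul, map_zero, h0, one_mul, ← expSMul_add]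
      push_cast
      ring_nf

theorem norm_lnExpConj_smul_le {X Y : M} (hX : IsSelfAdjoint X) (hY : IsSelfAdjoint Y)
    (hXI : X ∈ I.space) {t : ℝ} (ht0 : 0 ≤ t) (ht1 : t ≤ 1)
    (ht : lnExpConj (t • X) (t • Y) ∈ I.space) (h1 : lnExpConj X Y ∈ I.space) :
    ‖I.core _ ht‖ ≤ t * ‖I.core _ h1‖ := by
  set K := lnExpConj X Y with hKdef
  have hK : IsSelfAdjoint K := IsSelfAdjoint.log
  have hL : ∀ c : ℝ, logConj X (1 / 2) (c • K) ∈ I.space := fun c =>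
    logConj_mem hX (isSelfAdjoint_real_smul hK c) hXI (real_smul_mem h1 c) _
  have hC : ∀ c : ℝ, logConj X (-(t / 2)) (t • logConj X (1 / 2) (c • K)) ∈ I.space := fun c =>
    logConj_mem hX (isSelfAdjoint_real_smul (isSelfAdjoint_logConj _ _ _) t) hXI
      (real_smul_mem (hL c) t) _
  let C : ℝ → I.Core := fun c => I.core _ (hC c)
  have hC0 : C 0 = 0 := by
    apply val_injective
    change logConj X (-(t / 2)) (t • logConj X (1 / 2) ((0 : ℝ) • K)) = 0
    rw [zero_smul, logConj_zero hX, smul_smul,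
      show t * (2 * (1 / 2)) = 2 * (t / 2) by ring, ← logConj_zero hX]
    exact logConj_logConj_neg hX (IsSelfAdjoint.zero M) _
  have hC1 : C 1 = I.core _ ht := by
    apply val_injective
    change logConj X (-(t / 2)) (t • logConj X (1 / 2) ((1 : ℝ) • K)) = lnExpConj (t • X) (t • Y)
    have h := logConj_logConj_neg hX hY (-(1 / 2))
    rw [neg_neg] at h
    rw [one_smul, lnExpConj_smul, hKdef, lnExpConj_eq_logConj, h]
  have hstep : ∀ a b : ℝ, ‖C b - C a‖ ≤ t * ‖expDiff 0 (I.core K h1) ((b - a) / 2)‖ :=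
    norm_logConj_sub_logConj_le hX hK hXI h1 ht0 ht1 (1 / 2) (-(t / 2))
  -- n + 1 equal steps of C, each with argument x = 1/(2(n + 1)); the factor n + 1 is written as
  -- x⁻¹/2 to match `tendsto_expDiff`.
  have hsum : ∀ n : ℕ, ‖C 1‖ ≤ t * (1 / 2) *
      ((1 / 2 * (1 / ((n : ℝ) + 1)))⁻¹ *
        ‖expDiff 0 (I.core K h1) (1 / 2 * (1 / ((n : ℝ) + 1)))‖) := by
    intro n
    have hn : (n : ℝ) + 1 ≠ 0 := by positivity
    have h := dist_le_range_sum_of_dist_le (f := fun j : ℕ => C (j / ((n : ℝ) + 1))) (n + 1)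
      (d := fun _ => t * ‖expDiff 0 (I.core K h1) (1 / 2 * (1 / ((n : ℝ) + 1)))‖)
      (fun {k} _ => by
        rw [dist_comm, dist_eq_norm]
        refine (hstep _ _).trans_eq ?_
        congr 3
        push_cast
        ring)
    simp only [Nat.cast_zero, zero_div, hC0, dist_zero_left, Nat.cast_add, Nat.cast_one,
      div_self hn, Finset.sum_const, Finset.card_range, nsmul_eq_mul] at h
    refine h.trans_eq ?_
    field_simp
  rw [← hC1]
  have hlim : Filter.Tendsto (fun n : ℕ => 1 / 2 * (1 / ((n : ℝ) + 1))) Filter.atTop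
      (nhdsWithin 0 (Set.Ioi 0)) := by
    refine tendsto_nhdsWithin_iff.mpr ⟨?_, Filter.Eventually.of_forall fun n => ?_⟩
    · simpa using tendsto_one_div_add_atTop_nhds_zero_nat (𝕜 := ℝ) |>.const_mul (1 / 2 : ℝ)
    · exact Set.mem_Ioi.mpr (by positivity)
  have hl := ((tendsto_expDiff 0 (I.core K h1)).comp hlim).const_mul (t * (1 / 2))
  refine (ge_of_tendsto' hl hsum).trans_eq ?_
  rw [sub_zero]
  ring

end NormedIdeal

theorem mainTheorem5 {M : Type*} [CStarAlgebra M] (I : NormedIdeal M) (X Y : M)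
    (hX : IsSelfAdjoint X) (hY : IsSelfAdjoint Y) (hXI : X ∈ I.space) (hYI : Y ∈ I.space)
    (t : ℝ) (ht : t ∈ Set.Icc (0 : ℝ) 1) :
    ∃ (ht_mem : lnExpConj (t • X) (t • Y) ∈ I.space) (h1_mem : lnExpConj X Y ∈ I.space),
      ‖I.toCompleted (lnExpConj (t • X) (t • Y)) ht_mem‖ ≤
        t * ‖I.toCompleted (lnExpConj X Y) h1_mem‖ := by
  have ht_mem : lnExpConj (t • X) (t • Y) ∈ I.space := by
    rw [NormedIdeal.lnExpConj_smul]
    exact NormedIdeal.logConj_mem hX (NormedIdeal.isSelfAdjoint_real_smul hY t) hXI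
      (NormedIdeal.real_smul_mem hYI t) _
  have h1_mem : lnExpConj X Y ∈ I.space := NormedIdeal.logConj_mem hX hY hXI hYI _
  refine ⟨ht_mem, h1_mem, ?_⟩
  rw [NormedIdeal.norm_toCompleted, NormedIdeal.norm_toCompleted]
  exact NormedIdeal.norm_lnExpConj_smul_le hX hY hXI ht.1 ht.2 ht_mem h1_mem
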